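/- Let $\mathbb B^N=\{x\in\mathbb R^N:\|x\|_2\le 1\}$ and let $\Sigma_K\subset\mathbb R^N$ be the set of vectors with at most $K$ nonzero coordinates. For $\delta>0$ let $\mathcal Q_\delta(t)=\delta(\lfloor t/\delta\rfloor+\tfrac12)$, applied componentwise to vectors. Let $\Phi$ be an $M\times N$ random matrix with independent $\mathcal N(0,1)$ entries and let $\xi\in\mathbb R^M$ be a random vector, independent of $\Phi$, with independent components uniform on $[0,\delta]$. For $r\in\mathbb N$ and $\mathcal K\subset\mathbb R^N$ put $$\mathcal E^r_\delta(\Phi,\xi,\mathcal K)=\sup\{\|x-x^*\|_2:\ x,x^*\in\mathcal K,\ \|\mathcal Q_\delta(\Phi x+\xi)-\mathcal Q_\delta(\Phi x^*+\xi)\|_1\le r\delta\}.$$ For every $\Delta>0$ there are constants $C,C'>0$, depending only on $\Delta$, such that for all integers $M\ge 3$, $N\ge 1$, $r\ge 0$ and all real $0<\delta\le\Delta$, $0<\eta<1$: - (GRFCQ) with probability at least $1-\eta$, $$\mathcal E^r_\delta(\Phi,\xi,\mathbb B^N)\le C\,\frac{N+r}{M}\Big(\log\frac{M\max(N,M)}{N}+\log\frac1{2\eta}\Big);$$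 - (QCS) for every integer $1\le K\le N$, with probability at least $1-\eta$, $$\mathcal E^r_\delta(\Phi,\xi,\Sigma_K\cap\mathbb B^N)\le C'\,\frac{K+r}{M}\Big(\log\frac{M\max(N,M)}{K}+\log\frac1{2\eta}\Big).$$ -/

import Mathlib

open MeasureTheory ProbabilityTheory

noncomputable section

namespace QuantizedSensing

/-- The uniform midrise quantizer of resolution `δ`:
`Q_δ(t) = δ (⌊t / δ⌋ + 1 / 2)`. -/
def quantizer (δ t : ℝ) : ℝ := δ * ((⌊t / δ⌋ : ℝ) + 1 / 2)

/-- The dithered quantized projections `Q_δ(Φ x + ξ)`, with `Q_δ` applied componentwise. -/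
def quantizedProj {M N : ℕ} (δ : ℝ) (Φ : Fin M → Fin N → ℝ) (ξ : Fin M → ℝ)
    (x : EuclideanSpace ℝ (Fin N)) : Fin M → ℝ :=
  fun i => quantizer δ ((∑ j, Φ i j * x j) + ξ i)

/-- The relaxed consistency cell of `x` in `𝒦`: the elements of `𝒦` whose quantized projections
differ from those of `x` by at most `r δ` in `ℓ₁` norm. -/
def relaxedCell {M N : ℕ} (r : ℕ) (δ : ℝ) (Φ : Fin M → Fin N → ℝ) (ξ : Fin M → ℝ)
    (𝒦 : Set (EuclideanSpace ℝ (Fin N))) (x : EuclideanSpace ℝ (Fin N)) :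
    Set (EuclideanSpace ℝ (Fin N)) :=
  {y | y ∈ 𝒦 ∧ ∑ i, |quantizedProj δ Φ ξ y i - quantizedProj δ Φ ξ x i| ≤ r * δ}

/-- The worst-case error: the supremum of the distances `‖x - y‖` over all `x` in `𝒦` and all `y`
in the relaxed consistency cell of `x`. It is an extended real, so that the supremum always has
its usual meaning. -/
def worstCaseError {M N : ℕ} (r : ℕ) (δ : ℝ) (Φ : Fin M → Fin N → ℝ) (ξ : Fin M → ℝ)
    (𝒦 : Set (EuclideanSpace ℝ (Fin N))) : EReal :=
  ⨆ x ∈ 𝒦, ⨆ y ∈ relaxedCell r δ Φ ξ 𝒦 x, ((‖x - y‖ : ℝ) : EReal)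

/-- The closed Euclidean unit ball of `ℝ^N`. -/
def unitBall (N : ℕ) : Set (EuclideanSpace ℝ (Fin N)) := {x | ‖x‖ ≤ 1}

/-- The vectors of `ℝ^N` with at most `K` nonzero coordinates. -/
def sparseVectors (N K : ℕ) : Set (EuclideanSpace ℝ (Fin N)) := {x | {j | x j ≠ 0}.ncard ≤ K}

/-- The joint law of an `M × N` matrix with independent standard normal entries and of an
independent dithering with `M` independent components uniform on `[0, δ]`. -/
def sensingLaw (M N : ℕ) (δ : ℝ) : Measure ((Fin M → Fin N → ℝ) × (Fin M → ℝ)) :=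
  (Measure.pi fun _ => Measure.pi fun _ => gaussianReal 0 1).prod
    (Measure.pi fun _ => ProbabilityTheory.cond (volume : Measure ℝ) (Set.Icc 0 δ))

/-- `E` holds with probability at least `p`: it contains a measurable event of probability at
least `p`. For a measurable `E` this says `p ≤ μ E`; for other sets it is
stronger than the same inequality for the outer measure of `E`. -/
def HoldsWithProb {Ω : Type*} [MeasurableSpace Ω] (μ : Measure Ω) (p : ℝ) (E : Set Ω) : Prop :=
  ∃ G : Set Ω, MeasurableSet G ∧ G ⊆ E ∧ ENNReal.ofReal p ≤ μ G

end QuantizedSensing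

end

/-!
A pair of points of the ball is separated by a row `φ` with dither `s` when a threshold `m δ` of
the quantizer lies between the two dithered projections; each separating row contributes at least
`δ` to the `ℓ₁` distance of the quantized projections. So it suffices that, with high probability,
every two `K`-sparse points at distance more than `ε` are separated by more than `r` rows. The
result for the whole ball is the case `K = N`.

For two fixed points at distance of order `ε ≤ 2`, a row separates them with probability at least
`κ ε`, where `κ` depends only on the upper bound for `δ`: the Gaussian projections are at distance
of order `ε` with probability at least `1 / 2` (`half_le_prob_abs_sum_mul`), and given this a
threshold falls in between with probability of order `min 1 (ε / δ)`, because the separation event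
is `δ`-periodic in the dither (`prob_dither_separates`). This is robust: the projections of all
points of a cell that arises from moving `K` coordinates by at most `τ` vary by at most `τ` times
the sum of `K` entries `|φ j|`, which has mean at most `K τ`, so for `τ = ε / (64 K)` a row
separates the whole cells with comparable probability (`le_rowLaw_separatingRows`). As the rows are
independent, a Chernoff bound shows that at most `r` rows separate two given cells with probability
at most `exp (r - M κ ε / 2)` (`prob_card_le_le_exp`).

Rounding the coordinates to multiples of `τ` puts every `K`-sparse point of the ball in one of at
most `L ^ (7 K)` cells, where `L = M max(N, M) / K` (`card_sparseGrid_le`); here `ε` may be assumed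
to be at least `K / M`. A union bound over pairs of cells (`holdsWithProb_worstCaseError_le`) then
bounds the failure probability by `L ^ (14 K) exp (r - M κ ε / 2)`, which is at most `η` for `ε =
(84 / κ) ((K + r) / M) log (L / (2 η))` (`holdsWithProb_sparse`).
-/

noncomputable section

namespace QuantizedSensing

/-! ### Anti-concentration and moments of Gaussian rows -/

/-- A linear form in independent standard normals is centred normal, with variance the squared
Euclidean norm of its coefficients (by comparison of characteristic functions). -/
lemma map_pi_gaussianReal_sum_mul {N : ℕ} (v : Fin N → ℝ) :
    (Measure.pi fun _ : Fin N => gaussianReal 0 1).map (fun φ => ∑ j, φ j * v j) =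
      gaussianReal 0 (∑ j, v j ^ 2).toNNReal := by
  have hm : Measurable fun φ : Fin N → ℝ => ∑ j, φ j * v j := by fun_prop
  have : IsProbabilityMeasure
      ((Measure.pi fun _ : Fin N => gaussianReal 0 1).map (fun φ => ∑ j, φ j * v j)) :=
    Measure.isProbabilityMeasure_map hm.aemeasurable
  apply Measure.ext_of_charFun
  ext t
  rw [charFun_apply_real, integral_map hm.aemeasurable (by fun_prop)]
  have h1 : ∀ φ : Fin N → ℝ,
      Complex.exp ((t : ℂ) * ((∑ j, φ j * v j : ℝ) : ℂ) * Complex.I) =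
        ∏ j, Complex.exp (((t * v j : ℝ) : ℂ) * ((φ j : ℝ) : ℂ) * Complex.I) := by
    intro φ
    rw [← Complex.exp_sum]
    congr 1
    push_cast
    rw [Finset.mul_sum, Finset.sum_mul]
    exact Finset.sum_congr rfl fun j _ => by ring
  simp_rw [h1]
  rw [integral_fintype_prod_eq_prod
    (f := fun j x => Complex.exp (((t * v j : ℝ) : ℂ) * ((x : ℝ) : ℂ) * Complex.I))]
  simp_rw [← charFun_apply_real, charFun_gaussianReal]
  rw [← Complex.exp_sum]
  congr 1
  have h2 : (((∑ j, v j ^ 2).toNNReal : ℝ) : ℂ) = ∑ j, (v j : ℂ) ^ 2 := by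
    rw [Real.coe_toNNReal _ (Finset.sum_nonneg fun j _ => sq_nonneg _)]
    push_cast; rfl
  rw [h2]
  push_cast
  simp [mul_pow, mul_comm, Finset.mul_sum, Finset.sum_div]

/-- A centred normal variable of standard deviation `σ ≥ 2 s` lies in `(-s, s)` with probability at
most `1 / 2`, because its density is at most `1 / √(2 π σ ^ 2) ≤ 1 / (4 s)`. -/
lemma gaussianReal_abs_lt_le_half {v : NNReal} {s : ℝ} (hs : 0 < s) (hsv : 4 * s ^ 2 ≤ v) :
    (gaussianReal 0 v).real {x | |x| < s} ≤ 1 / 2 := by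
  have hv0 : (0 : ℝ) < v := by nlinarith [sq_pos_of_pos hs]
  have hv : v ≠ 0 := by
    rintro rfl; simp at hv0
  have hset : {x : ℝ | |x| < s} = Set.Ioo (-s) s := by ext x; simp [abs_lt]
  have hpdf : ∀ x, gaussianPDF 0 v x ≤ ENNReal.ofReal (√(2 * Real.pi * v))⁻¹ := by
    intro x
    refine ENNReal.ofReal_le_ofReal ?_
    rw [gaussianPDFReal_def]
    refine mul_le_of_le_one_right (by positivity) (Real.exp_le_one_iff.2 ?_)
    exact div_nonpos_of_nonpos_of_nonneg (neg_nonpos.2 (sq_nonneg _)) (by positivity)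
  have hroot : 4 * s ≤ √(2 * Real.pi * v) := by
    apply Real.le_sqrt_of_sq_le
    nlinarith [Real.pi_gt_three]
  rw [hset, measureReal_def, gaussianReal_apply _ hv]
  refine ENNReal.toReal_le_of_le_ofReal (by norm_num) ?_
  calc ∫⁻ x in Set.Ioo (-s) s, gaussianPDF 0 v x
      ≤ ∫⁻ _ in Set.Ioo (-s) s, ENNReal.ofReal (√(2 * Real.pi * v))⁻¹ := lintegral_mono hpdf
    _ = ENNReal.ofReal ((√(2 * Real.pi * v))⁻¹ * (2 * s)) := by
        rw [setLIntegral_const, Real.volume_Ioo, ← ENNReal.ofReal_mul (by positivity)]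
        congr 2; ring
    _ ≤ ENNReal.ofReal (1 / 2) := by
        refine ENNReal.ofReal_le_ofReal ?_
        rw [inv_mul_le_iff₀ (by linarith)]
        linarith

lemma half_le_prob_abs_sum_mul {N : ℕ} (v : Fin N → ℝ) {s : ℝ} (hs : 0 < s)
    (hsv : 4 * s ^ 2 ≤ ∑ j, v j ^ 2) :
    (1 : ℝ) / 2 ≤ (Measure.pi fun _ : Fin N => gaussianReal 0 1).real
      {φ | s ≤ |∑ j, φ j * v j|} := by
  have hm : Measurable fun φ : Fin N → ℝ => ∑ j, φ j * v j := by fun_prop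
  have hms : MeasurableSet {x : ℝ | |x| < s} := measurableSet_lt (by fun_prop) (by fun_prop)
  have h := gaussianReal_abs_lt_le_half (v := (∑ j, v j ^ 2).toNNReal) hs
    (hsv.trans (Real.le_coe_toNNReal _))
  rw [← map_pi_gaussianReal_sum_mul, map_measureReal_apply hm hms] at h
  have h2 := probReal_compl_eq_one_sub (μ := Measure.pi fun _ : Fin N => gaussianReal 0 1)
    (hms.preimage hm)
  have h3 : ((fun φ : Fin N → ℝ => ∑ j, φ j * v j) ⁻¹' {x : ℝ | |x| < s})ᶜ =
      {φ | s ≤ |∑ j, φ j * v j|} := by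
    ext φ; simp
  rw [h3] at h2
  linarith

lemma integral_abs_gaussianReal_le_one : ∫ x, |x| ∂(gaussianReal 0 1) ≤ 1 := by
  have h2 : Integrable (fun x : ℝ => x ^ 2) (gaussianReal 0 1) :=
    (memLp_id_gaussianReal 2).integrable_sq
  have h1 : Integrable (fun x : ℝ => |x|) (gaussianReal 0 1) :=
    ((memLp_id_gaussianReal 1).integrable (by simp)).abs
  have h3 : ∫ x, x ^ 2 ∂(gaussianReal 0 1) = 1 := by
    have h := variance_fun_id_gaussianReal (μ := 0) (v := 1)
    rw [variance_of_integral_eq_zero (by fun_prop) (by simp)] at h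
    simpa using h
  calc ∫ x, |x| ∂(gaussianReal 0 1) ≤ ∫ x, (1 + x ^ 2) / 2 ∂(gaussianReal 0 1) :=
        integral_mono h1 (((integrable_const 1).add h2).div_const 2) fun x => by
          have := sq_nonneg (|x| - 1)
          have h5 := sq_abs x
          show |x| ≤ (1 + x ^ 2) / 2
          nlinarith
    _ = 1 := by
        rw [integral_div, integral_add (integrable_const 1) h2, h3]; simp

/-- Markov's inequality for the `ℓ₁` norms of the restrictions of a Gaussian row to `T` and `S`. -/
lemma prob_sum_abs_ge_le {N : ℕ} (T S : Finset (Fin N)) {a : ℝ} (ha : 0 < a) :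
    (Measure.pi fun _ : Fin N => gaussianReal 0 1).real
      {φ | a ≤ ∑ j ∈ T, |φ j| + ∑ j ∈ S, |φ j|} ≤ (T.card + S.card) / a := by
  have h1 : Integrable (fun x : ℝ => |x|) (gaussianReal 0 1) :=
    ((memLp_id_gaussianReal 1).integrable (by simp)).abs
  have hint : ∀ j : Fin N, Integrable (fun φ : Fin N → ℝ => |φ j|)
      (Measure.pi fun _ : Fin N => gaussianReal 0 1) := fun j =>
    integrable_comp_eval (μ := fun _ : Fin N => gaussianReal 0 1) (i := j) h1
  have hval : ∀ j : Fin N, ∫ φ, |φ j| ∂(Measure.pi fun _ : Fin N => gaussianReal 0 1) ≤ 1 := by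
    intro j
    rw [integral_comp_eval (μ := fun _ : Fin N => gaussianReal 0 1) (i := j)
      (f := fun x : ℝ => |x|) h1.aestronglyMeasurable]
    exact integral_abs_gaussianReal_le_one
  have hsum : ∀ R : Finset (Fin N), ∫ φ, ∑ j ∈ R, |φ j|
      ∂(Measure.pi fun _ : Fin N => gaussianReal 0 1) ≤ R.card := by
    intro R
    rw [integral_finsetSum _ fun j _ => hint j]
    calc _ ≤ ∑ j ∈ R, (1 : ℝ) := Finset.sum_le_sum fun j _ => hval j
      _ = R.card := by simp
  have hI : ∀ R : Finset (Fin N), Integrable (fun φ : Fin N → ℝ => ∑ j ∈ R, |φ j|)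
      (Measure.pi fun _ : Fin N => gaussianReal 0 1) := fun R =>
    integrable_finsetSum _ fun j _ => hint j
  have hM := mul_meas_ge_le_integral_of_nonneg
    (μ := Measure.pi fun _ : Fin N => gaussianReal 0 1)
    (f := fun φ : Fin N → ℝ => ∑ j ∈ T, |φ j| + ∑ j ∈ S, |φ j|)
    (Filter.Eventually.of_forall fun φ => by
      show (0 : ℝ) ≤ ∑ j ∈ T, |φ j| + ∑ j ∈ S, |φ j|
      positivity) ((hI T).add (hI S)) a
  rw [integral_add (hI T) (hI S)] at hM
  rw [le_div_iff₀ ha, mul_comm]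
  exact hM.trans (add_le_add (hsum T) (hsum S))

/-! ### Lower tail of the number of successes -/

/-- A Chernoff bound: if each of `M` independent trials succeeds with probability at least `p`, at
most `r` of them succeed with probability at most `exp (r - M p / 2)`. It is Markov's inequality
for `exp (-#successes)`, with `1 - exp (-1) ≥ 1 / 2`. -/
lemma prob_card_le_le_exp {α : Type*} [MeasurableSpace α] (ρ : Measure α) [IsProbabilityMeasure ρ]
    (M r : ℕ) {D : Set α} (hD : MeasurableSet D) {p : ℝ} (hp : p ≤ ρ.real D) :
    (Measure.pi fun _ : Fin M => ρ).real {ω | {i | ω i ∈ D}.ncard ≤ r} ≤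
      Real.exp (r - M * p / 2) := by
  classical
  -- `∏ i, (1 + f (ω i)) = exp (-#successes)`, since `1 + f` is `exp (-1)` on `D` and `1` elsewhere.
  set f : α → ℝ := D.indicator fun _ => Real.exp (-1) - 1 with hf
  have hfm : Measurable f := measurable_const.indicator hD
  have hfval : ∀ a, 0 ≤ 1 + f a := by
    intro a
    by_cases h : a ∈ D <;> simp [hf, h, Real.exp_nonneg]
  have hfle : ∀ a, 1 + f a ≤ 1 := by
    intro a
    by_cases h : a ∈ D <;> simp [hf, h]
  have hfint : Integrable f ρ := (integrable_const _).indicator hD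
  have hIf : ∫ a, (1 + f a) ∂ρ ≤ Real.exp (-(p / 2)) := by
    rw [integral_add (integrable_const 1) hfint, hf, integral_indicator_const _ hD]
    have he : Real.exp (-1) ≤ 1 / 2 := by
      rw [Real.exp_neg, one_div]
      exact inv_anti₀ (by norm_num) (by have := Real.add_one_le_exp 1; linarith)
    have h0 : 0 ≤ ρ.real D := measureReal_nonneg
    have := Real.add_one_le_exp (-(p / 2))
    simp only [integral_const, probReal_univ, smul_eq_mul, mul_one]
    nlinarith
  have hprod : ∀ ω : Fin M → α, ∏ i, (1 + f (ω i)) = Real.exp (-({i | ω i ∈ D}.ncard : ℝ)) := by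
    intro ω
    have h1 : ∀ i, 1 + f (ω i) = if ω i ∈ D then Real.exp (-1) else 1 := by
      intro i
      by_cases h : ω i ∈ D <;> simp [hf, h]
    simp_rw [h1]
    rw [Finset.prod_ite, Finset.prod_const_one, mul_one, Finset.prod_const, ← Real.exp_nat_mul]
    congr 1
    rw [Set.ncard_eq_toFinset_card']
    simp
  have hint : Integrable (fun ω : Fin M → α => ∏ i, (1 + f (ω i)))
      (Measure.pi fun _ : Fin M => ρ) := by
    refine Integrable.of_bound (C := 1) ?_ ?_
    · exact (Finset.measurable_prod _ fun i _ =>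
        (measurable_const.add (hfm.comp (measurable_pi_apply i)))).aestronglyMeasurable
    · refine Filter.Eventually.of_forall fun ω => ?_
      rw [hprod, Real.norm_eq_abs, Real.abs_exp]
      simp
  have hM := mul_meas_ge_le_integral_of_nonneg
    (Filter.Eventually.of_forall fun ω => Finset.prod_nonneg fun i _ => hfval (ω i)) hint
    (Real.exp (-(r : ℝ)))
  have hset : {ω : Fin M → α | Real.exp (-(r : ℝ)) ≤ ∏ i, (1 + f (ω i))} =
      {ω | {i | ω i ∈ D}.ncard ≤ r} := by
    ext ω
    simp only [Set.mem_ofPred_eq, hprod, Real.exp_le_exp, neg_le_neg_iff, Nat.cast_le]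
  rw [hset, integral_fintype_prod_eq_pow (fun a => 1 + f a), Fintype.card_fin] at hM
  have hpow : (∫ a, (1 + f a) ∂ρ) ^ M ≤ Real.exp (-(p / 2)) ^ M :=
    pow_le_pow_left₀ (integral_nonneg hfval) hIf M
  rw [← Real.exp_nat_mul] at hpow
  have h3 := hM.trans hpow
  rw [show (r : ℝ) - M * p / 2 = r + M * (-(p / 2)) by ring, Real.exp_add]
  have h4 : Real.exp r * Real.exp (-(r : ℝ)) = 1 := by rw [← Real.exp_add]; simp
  calc _ = Real.exp r * (Real.exp (-(r : ℝ)) *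
        (Measure.pi fun _ : Fin M => ρ).real {ω | {i | ω i ∈ D}.ncard ≤ r}) := by
        rw [← mul_assoc, h4, one_mul]
    _ ≤ _ := mul_le_mul_of_nonneg_left h3 (Real.exp_nonneg _)

/-! ### The effect of the dither -/

lemma measurableSet_exists_int_mul_separates {α : Type*} [MeasurableSpace α] (δ : ℝ) {f g : α → ℝ}
    (hf : Measurable f) (hg : Measurable g) :
    MeasurableSet {x | ∃ m : ℤ, f x < m * δ ∧ m * δ ≤ g x} := by
  have h : {x | ∃ m : ℤ, f x < m * δ ∧ m * δ ≤ g x} =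
      ⋃ m : ℤ, ({x | f x < m * δ} ∩ {x | m * δ ≤ g x}) := by
    ext x; simp
  rw [h]
  exact MeasurableSet.iUnion fun m => (measurableSet_lt hf measurable_const).inter
    (measurableSet_le measurable_const hg)

/-- A uniform dither on `[0, δ]` moves a threshold `m δ` of the quantizer into the interval `(a, b]`
with probability at least `min 1 ((b - a) / δ)`. -/
lemma prob_dither_separates {δ a b : ℝ} (hδ : 0 < δ) (hab : a ≤ b) :
    min 1 ((b - a) / δ) ≤ (ProbabilityTheory.cond (volume : Measure ℝ) (Set.Icc 0 δ)).real
      {s | ∃ m : ℤ, a + s < m * δ ∧ m * δ ≤ b + s} := by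
  set A : Set ℝ := {s | ∃ m : ℤ, a + s < m * δ ∧ m * δ ≤ b + s} with hA
  have hAm : MeasurableSet A := measurableSet_exists_int_mul_separates δ (by fun_prop) (by fun_prop)
  have hper : Function.Periodic (A.indicator (fun _ => (1 : ℝ))) δ := by
    intro s
    have : s + δ ∈ A ↔ s ∈ A := by
      constructor
      · rintro ⟨m, h1, h2⟩
        exact ⟨m - 1, by push_cast; linarith, by push_cast; linarith⟩
      · rintro ⟨m, h1, h2⟩
        exact ⟨m + 1, by push_cast; linarith, by push_cast; linarith⟩
    by_cases h : s ∈ A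
    · rw [Set.indicator_of_mem h, Set.indicator_of_mem (this.2 h)]
    · rw [Set.indicator_of_notMem h, Set.indicator_of_notMem (fun h' => h (this.1 h'))]
  have hval : ∀ t : ℝ, ∫ x in t..t + δ, A.indicator (fun _ => (1 : ℝ)) x =
      volume.real (A ∩ Set.Ioc t (t + δ)) := by
    intro t
    rw [intervalIntegral.integral_of_le (by linarith), integral_indicator_const _ hAm,
      measureReal_restrict_apply hAm]
    simp
  -- The event is `δ`-periodic in the dither, so the window `(0, δ]` may be replaced by
  -- `(-b, -b + δ]`, at the beginning of which the threshold `0` separates.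
  have h1 := hper.intervalIntegral_add_eq 0 (-b)
  rw [hval, hval, zero_add] at h1
  set d := min δ (b - a) with hd
  have hd0 : 0 ≤ d := le_min hδ.le (by linarith)
  have hsub : Set.Ioo (-b) (-b + d) ⊆ A ∩ Set.Ioc (-b) (-b + δ) := by
    rintro s ⟨hs1, hs2⟩
    have hd1 : d ≤ δ := min_le_left _ _
    have hd2 : d ≤ b - a := min_le_right _ _
    refine ⟨⟨0, ?_, ?_⟩, hs1, by linarith⟩
    · push_cast; linarith
    · push_cast; linarith
  have hfin : ∀ t, volume (A ∩ Set.Ioc t (t + δ)) ≠ ⊤ := fun t =>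
    ((measure_mono Set.inter_subset_right).trans_lt measure_Ioc_lt_top).ne
  have h2 : d ≤ volume.real (A ∩ Set.Ioc (-b) (-b + δ)) := by
    have h := measureReal_mono hsub (hfin _)
    rwa [Real.volume_real_Ioo_of_le (by linarith), add_sub_cancel_left] at h
  have h3 : d ≤ volume.real (Set.Icc 0 δ ∩ A) := by
    rw [← h1] at h2
    refine h2.trans (measureReal_mono ?_ ?_)
    · exact fun s hs => ⟨Set.Ioc_subset_Icc_self hs.2, hs.1⟩
    · exact ((measure_mono Set.inter_subset_left).trans_lt measure_Icc_lt_top).ne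
  rw [measureReal_def, cond_apply measurableSet_Icc, ENNReal.toReal_mul, ENNReal.toReal_inv,
    ← measureReal_def, ← measureReal_def, Real.volume_real_Icc_of_le hδ.le, sub_zero]
  have h4 : min 1 ((b - a) / δ) = δ⁻¹ * d := by
    rw [hd, mul_min_of_nonneg _ _ (by positivity), inv_mul_cancel₀ hδ.ne', div_eq_inv_mul]
  rw [h4]
  exact mul_le_mul_of_nonneg_left h3 (by positivity)

/-! ### Independence of the rows -/

/-- The joint law of one row of the sensing matrix and of the corresponding dither component. -/
def rowLaw (N : ℕ) (δ : ℝ) : Measure ((Fin N → ℝ) × ℝ) :=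
  (Measure.pi fun _ : Fin N => gaussianReal 0 1).prod
    (ProbabilityTheory.cond (volume : Measure ℝ) (Set.Icc 0 δ))

lemma isProbabilityMeasure_dither {δ : ℝ} (hδ : 0 < δ) :
    IsProbabilityMeasure (ProbabilityTheory.cond (volume : Measure ℝ) (Set.Icc 0 δ)) :=
  cond_isProbabilityMeasure_of_finite (by simp [hδ]) (by simp)

lemma isProbabilityMeasure_rowLaw {N : ℕ} {δ : ℝ} (hδ : 0 < δ) :
    IsProbabilityMeasure (rowLaw N δ) := by
  have := isProbabilityMeasure_dither hδ
  unfold rowLaw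
  infer_instance

lemma isProbabilityMeasure_sensingLaw {M N : ℕ} {δ : ℝ} (hδ : 0 < δ) :
    IsProbabilityMeasure (sensingLaw M N δ) := by
  have := isProbabilityMeasure_dither hδ
  unfold sensingLaw
  infer_instance

/-- Under `sensingLaw`, the pairs formed by a row of the matrix and its dither component are
independent with law `rowLaw`. -/
lemma sensingLaw_real_rows {M N : ℕ} {δ : ℝ} (hδ : 0 < δ) (A : Set (Fin M → (Fin N → ℝ) × ℝ)) :
    (sensingLaw M N δ).real {ω | (fun i => (ω.1 i, ω.2 i)) ∈ A} =
      (Measure.pi fun _ : Fin M => rowLaw N δ).real A := by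
  have := isProbabilityMeasure_dither hδ
  have h := measurePreserving_arrowProdEquivProdArrow (Fin N → ℝ) ℝ (Fin M)
    (fun _ => Measure.pi fun _ : Fin N => gaussianReal 0 1)
    (fun _ => ProbabilityTheory.cond (volume : Measure ℝ) (Set.Icc 0 δ))
  exact congrArg ENNReal.toReal (h.symm.measure_preimage_equiv A)

lemma measureReal_mul_le_prod_real {α β : Type*} [MeasurableSpace α] [MeasurableSpace β]
    (μ : Measure α) (ν : Measure β) [IsFiniteMeasure μ] [IsFiniteMeasure ν] {E : Set (α × β)}
    (hE : MeasurableSet E) {F : Set α} (hF : MeasurableSet F) {c : ℝ} (hc : 0 ≤ c)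
    (h : ∀ x ∈ F, c ≤ ν.real {y | (x, y) ∈ E}) : μ.real F * c ≤ (μ.prod ν).real E := by
  have h1 : μ F * ENNReal.ofReal c ≤ (μ.prod ν) E := by
    rw [Measure.prod_apply hE, mul_comm, ← setLIntegral_const]
    refine (setLIntegral_mono' hF fun x hx => ?_).trans (setLIntegral_le_lintegral F _)
    exact (ENNReal.ofReal_le_ofReal (h x hx)).trans ENNReal.ofReal_toReal_le
  have h2 := ENNReal.toReal_mono (measure_ne_top _ _) h1
  rwa [ENNReal.toReal_mul, ENNReal.toReal_ofReal hc] at h2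

/-! ### Rows that separate two small cells -/

/-- The pairs (row `φ`, dither `s`) for which some threshold `m δ` of the quantizer lies between
`⟨φ, p⟩ + s` and `⟨φ, q⟩ + s` with margins `τ ∑ j ∈ T, |φ j|` at `p` and `τ ∑ j ∈ S, |φ j|` at
`q`. The margins bound the change of `⟨φ, p⟩` and `⟨φ, q⟩` when the coordinates of `p` in `T` and of
`q` in `S` move by at most `τ`, so such a row distinguishes all points of the two cells. -/
def separatingRows {N : ℕ} (δ τ : ℝ) (p q : Fin N → ℝ) (T S : Finset (Fin N)) :
    Set ((Fin N → ℝ) × ℝ) :=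
  {w | (∃ m : ℤ, ∑ j, w.1 j * p j + τ * ∑ j ∈ T, |w.1 j| + w.2 < m * δ ∧
      m * δ ≤ ∑ j, w.1 j * q j - τ * ∑ j ∈ S, |w.1 j| + w.2) ∨
    ∃ m : ℤ, ∑ j, w.1 j * q j + τ * ∑ j ∈ S, |w.1 j| + w.2 < m * δ ∧
      m * δ ≤ ∑ j, w.1 j * p j - τ * ∑ j ∈ T, |w.1 j| + w.2}

lemma measurableSet_separatingRows {N : ℕ} (δ τ : ℝ) (p q : Fin N → ℝ) (T S : Finset (Fin N)) :
    MeasurableSet (separatingRows δ τ p q T S) :=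
  (measurableSet_exists_int_mul_separates δ (by fun_prop) (by fun_prop)).union
    (measurableSet_exists_int_mul_separates δ (by fun_prop) (by fun_prop))

/-- If `p` and `q` are at distance at least `ε / 2`, a row separates their cells with probability
of order `min 1 (ε / δ)`: with probability at least `1 / 4` the projections `⟨φ, p⟩` and `⟨φ, q⟩`
are at least `ε / 4` apart while the margins add up to less than `ε / 8`, and then the dither does
the rest. -/
lemma le_rowLaw_separatingRows {N : ℕ} {K : ℕ} {δ τ ε : ℝ} (hδ : 0 < δ) (hτ : 0 < τ) (hε : 0 < ε)
    (hτε : 64 * K * τ ≤ ε) {p q : Fin N → ℝ} (hpq : ε ^ 2 / 4 ≤ ∑ j, (p j - q j) ^ 2)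
    {T S : Finset (Fin N)} (hT : T.card = K) (hS : S.card = K) :
    1 / 4 * min 1 (ε / (8 * δ)) ≤ (rowLaw N δ).real (separatingRows δ τ p q T S) := by
  have := isProbabilityMeasure_dither hδ
  set γ := Measure.pi fun _ : Fin N => gaussianReal 0 1
  set A : Set (Fin N → ℝ) := {φ | ε / 4 ≤ |∑ j, φ j * (p j - q j)|}
  set B : Set (Fin N → ℝ) := {φ | ε / (8 * τ) ≤ ∑ j ∈ T, |φ j| + ∑ j ∈ S, |φ j|}
  have hAm : MeasurableSet A := measurableSet_le (by fun_prop) (by fun_prop)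
  have hBm : MeasurableSet B := measurableSet_le (by fun_prop) (by fun_prop)
  have hA : 1 / 2 ≤ γ.real A := half_le_prob_abs_sum_mul _ (by positivity) (by nlinarith)
  have hB : γ.real B ≤ 1 / 4 := by
    refine (prob_sum_abs_ge_le T S (by positivity)).trans ?_
    rw [hT, hS, div_div_eq_mul_div, div_le_iff₀ hε]
    linarith
  have hAB : 1 / 4 ≤ γ.real (A \ B) := by
    have := le_measureReal_sdiff (μ := γ) (s₁ := A) (s₂ := B)
    linarith
  have hc : 0 ≤ min 1 (ε / (8 * δ)) := by positivity
  refine (mul_le_mul_of_nonneg_right hAB hc).trans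
    (measureReal_mul_le_prod_real _ _ (measurableSet_separatingRows δ τ p q T S)
      (hAm.diff hBm) hc ?_)
  rintro φ ⟨hφA, hφB⟩
  replace hφA : ε / 4 ≤ |∑ j, φ j * (p j - q j)| := hφA
  replace hφB : ∑ j ∈ T, |φ j| + ∑ j ∈ S, |φ j| < ε / (8 * τ) := not_le.1 hφB
  rw [lt_div_iff₀ (by positivity)] at hφB
  simp_rw [mul_sub, Finset.sum_sub_distrib] at hφA
  have key : ∀ a b : ℝ, ε / 8 ≤ b - a → min 1 (ε / (8 * δ)) ≤
      (ProbabilityTheory.cond (volume : Measure ℝ) (Set.Icc 0 δ)).real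
        {s | ∃ m : ℤ, a + s < m * δ ∧ m * δ ≤ b + s} := by
    intro a b hab
    refine le_trans (min_le_min_left _ ?_) (prob_dither_separates hδ (by linarith))
    rw [← div_div]
    gcongr
  rcases le_abs.1 hφA with h | h
  · refine (key (∑ j, φ j * q j + τ * ∑ j ∈ S, |φ j|) (∑ j, φ j * p j - τ * ∑ j ∈ T, |φ j|)
      (by linarith)).trans (measureReal_mono ?_)
    exact fun s hs => Or.inr hs
  · refine (key (∑ j, φ j * p j + τ * ∑ j ∈ T, |φ j|) (∑ j, φ j * q j - τ * ∑ j ∈ S, |φ j|)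
      (by linarith)).trans (measureReal_mono ?_)
    exact fun s hs => Or.inl hs

lemma quantizer_sub_ge {δ u v : ℝ} (hδ : 0 < δ) {m : ℤ} (hu : u < m * δ) (hv : m * δ ≤ v) :
    δ ≤ quantizer δ v - quantizer δ u := by
  have h1 : ⌊u / δ⌋ < m := Int.floor_lt.2 ((div_lt_iff₀ hδ).2 hu)
  have h2 : m ≤ ⌊v / δ⌋ := Int.le_floor.2 ((le_div_iff₀ hδ).2 hv)
  have h3 : (⌊u / δ⌋ : ℝ) + 1 ≤ ⌊v / δ⌋ := by exact_mod_cast h1.trans_le h2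
  unfold quantizer
  nlinarith

lemma abs_sum_mul_sub_le {N : ℕ} {τ : ℝ} {x p : Fin N → ℝ} {T : Finset (Fin N)}
    (h : ∀ j, |x j - p j| ≤ if j ∈ T then τ else 0) (φ : Fin N → ℝ) :
    |∑ j, φ j * x j - ∑ j, φ j * p j| ≤ τ * ∑ j ∈ T, |φ j| := by
  rw [← Finset.sum_sub_distrib]
  refine (Finset.abs_sum_le_sum_abs _ _).trans ?_
  calc ∑ j, |φ j * x j - φ j * p j| ≤ ∑ j, if j ∈ T then τ * |φ j| else 0 := by
        refine Finset.sum_le_sum fun j _ => ?_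
        rw [← mul_sub, abs_mul]
        have h1 := mul_le_mul_of_nonneg_left (h j) (abs_nonneg (φ j))
        split_ifs at h1 ⊢ <;> linarith
    _ = τ * ∑ j ∈ T, |φ j| := by
        rw [Finset.mul_sum, ← Finset.sum_filter]; simp

/-- A separating row gives quantized projections at least `δ` apart, for all points of the two
cells. -/
lemma le_abs_quantizer_sub {N : ℕ} {δ τ : ℝ} (hδ : 0 < δ) {x y p q : Fin N → ℝ}
    {T S : Finset (Fin N)} (hx : ∀ j, |x j - p j| ≤ if j ∈ T then τ else 0)
    (hy : ∀ j, |y j - q j| ≤ if j ∈ S then τ else 0) {φ : Fin N → ℝ} {s : ℝ}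
    (h : (φ, s) ∈ separatingRows δ τ p q T S) :
    δ ≤ |quantizer δ (∑ j, φ j * y j + s) - quantizer δ (∑ j, φ j * x j + s)| := by
  have h1 := abs_le.1 (abs_sum_mul_sub_le hx φ)
  have h2 := abs_le.1 (abs_sum_mul_sub_le hy φ)
  rcases h with ⟨m, ha, hb⟩ | ⟨m, ha, hb⟩ <;> dsimp only at ha hb
  · exact (quantizer_sub_ge hδ (by linarith) (by linarith)).trans (le_abs_self _)
  · rw [abs_sub_comm]
    exact (quantizer_sub_ge hδ (by linarith) (by linarith)).trans (le_abs_self _)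

/-- If `y` is in the relaxed cell of `x`, at most `r` rows separate the grid cells of `x` and `y`.
-/
lemma ncard_separatingRows_le {M N r : ℕ} {δ τ : ℝ} (hδ : 0 < δ) {Φ : Fin M → Fin N → ℝ}
    {ξ : Fin M → ℝ} {𝒦 : Set (EuclideanSpace ℝ (Fin N))} {x y : EuclideanSpace ℝ (Fin N)}
    {p q : Fin N → ℝ} {T S : Finset (Fin N)} (hx : ∀ j, |x j - p j| ≤ if j ∈ T then τ else 0)
    (hy : ∀ j, |y j - q j| ≤ if j ∈ S then τ else 0) (hxy : y ∈ relaxedCell r δ Φ ξ 𝒦 x) :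
    {i | (Φ i, ξ i) ∈ separatingRows δ τ p q T S}.ncard ≤ r := by
  classical
  have h1 : δ * ({i | (Φ i, ξ i) ∈ separatingRows δ τ p q T S}.ncard : ℝ) ≤ r * δ := by
    refine le_trans ?_ hxy.2
    rw [Set.ncard_eq_toFinset_card', mul_comm, ← nsmul_eq_mul, ← Finset.sum_const]
    refine (Finset.sum_le_sum fun i hi => ?_).trans
      (Finset.sum_le_sum_of_subset_of_nonneg (Finset.subset_univ _) fun i _ _ => abs_nonneg _)
    exact le_abs_quantizer_sub hδ hx hy (by simpa using hi)
  rw [mul_comm] at h1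
  exact_mod_cast le_of_mul_le_mul_right h1 hδ

/-! ### A grid for sparse vectors -/

/-- The pairs of a support `T` of size `K` and of an integer vector supported in `T`, with entries
in `[-n, n]`. The pair `(T, k)` stands for the grid point `τ k`; keeping `T` records which
coordinates of the vectors rounded to it may differ from those of `τ k`. -/
def sparseGrid (N K n : ℕ) : Finset (Σ _ : Finset (Fin N), Fin N → ℤ) :=
  (Finset.univ.powersetCard K).sigma fun T =>
    Fintype.piFinset fun j => if j ∈ T then Finset.Icc (-n : ℤ) n else {0}

lemma card_sparseGrid (N K n : ℕ) :
    (sparseGrid N K n).card = N.choose K * (2 * n + 1) ^ K := by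
  rw [sparseGrid, Finset.card_sigma]
  have h : ∀ T ∈ (Finset.univ : Finset (Fin N)).powersetCard K,
      (Fintype.piFinset fun j => if j ∈ T then Finset.Icc (-n : ℤ) n else {0}).card =
        (2 * n + 1) ^ K := by
    intro T hT
    rw [Fintype.card_piFinset]
    have h1 : ∀ j, (if j ∈ T then Finset.Icc (-n : ℤ) n else {0}).card =
        if j ∈ T then 2 * n + 1 else 1 := by
      intro j
      split_ifs
      · rw [Int.card_Icc]; omega
      · simp
    simp_rw [h1]
    rw [Finset.prod_ite_mem, Finset.univ_inter, Finset.prod_const, (Finset.mem_powersetCard.1 hT).2]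
  rw [Finset.sum_congr rfl h, Finset.sum_const, Finset.card_powersetCard, Finset.card_univ,
    Fintype.card_fin, smul_eq_mul]

/-- Rounding the coordinates down to multiples of `τ` preserves zeros, hence the support. -/
lemma exists_mem_sparseGrid {N K n : ℕ} (hKN : K ≤ N) {τ : ℝ} (hτ : 0 < τ) (hn : 1 / τ ≤ n)
    {x : EuclideanSpace ℝ (Fin N)} (hx : x ∈ sparseVectors N K ∩ unitBall N) :
    ∃ g ∈ sparseGrid N K n, ∀ j, |x j - τ * g.2 j| ≤ if j ∈ g.1 then τ else 0 := by
  classical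
  obtain ⟨hxK, hx1⟩ := hx
  obtain ⟨T, hxT, -, hT⟩ := Finset.exists_subsuperset_card_eq (n := K)
    (Finset.subset_univ {j : Fin N | x j ≠ 0}.toFinset)
    (by rw [← Set.ncard_eq_toFinset_card']; exact hxK) (by simpa using hKN)
  have hx0 : ∀ j ∉ T, x j = 0 := fun j hj => by
    by_contra h
    exact hj (hxT (by simpa using h))
  have hxj : ∀ j, |x j| ≤ 1 := fun j => (PiLp.norm_apply_le x j).trans hx1
  refine ⟨⟨T, fun j => ⌊x j / τ⌋⟩, ?_, fun j => ?_⟩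
  · refine Finset.mem_sigma.2 ⟨Finset.mem_powersetCard.2 ⟨Finset.subset_univ _, hT⟩, ?_⟩
    refine Fintype.mem_piFinset.2 fun j => ?_
    dsimp only
    split_ifs with hj
    · have h1 : |x j / τ| ≤ n := by
        rw [abs_div, abs_of_pos hτ]
        exact (div_le_div_of_nonneg_right (hxj j) hτ.le).trans hn
      rw [abs_le] at h1
      refine Finset.mem_Icc.2 ⟨Int.le_floor.2 (by push_cast; exact h1.1), ?_⟩
      have h2 : (⌊x j / τ⌋ : ℝ) ≤ ((n : ℤ) : ℝ) := (Int.floor_le _).trans (by exact_mod_cast h1.2)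
      exact_mod_cast h2
    · simp [hx0 j hj]
  · dsimp only
    split_ifs with hj
    · have h1 := Int.floor_le (x j / τ)
      have h2 := Int.lt_floor_add_one (x j / τ)
      rw [le_div_iff₀ hτ] at h1
      rw [div_lt_iff₀ hτ] at h2
      rw [abs_le]
      constructor <;> linarith
    · simp [hx0 j hj]

lemma norm_sub_le_of_abs_sub_le {N : ℕ} {τ : ℝ} {x p : EuclideanSpace ℝ (Fin N)}
    {T : Finset (Fin N)} (h : ∀ j, |x j - p j| ≤ if j ∈ T then τ else 0) :
    ‖x - p‖ ≤ T.card * τ := by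
  have h1 : ‖x - p‖ ≤ ∑ j, |x j - p j| := by
    rw [EuclideanSpace.norm_eq]
    refine Real.sqrt_le_iff.2 ⟨by positivity, ?_⟩
    simpa using Finset.sum_sq_le_sq_sum_of_nonneg (s := Finset.univ)
      (f := fun j => |x j - p j|) fun j _ => abs_nonneg _
  refine h1.trans ((Finset.sum_le_sum fun j _ => h j).trans ?_)
  simp

lemma sq_div_four_le_sum_sq_sub {N K : ℕ} {τ ε : ℝ} (hε : 0 < ε) (hτε : 64 * K * τ ≤ ε)
    {x y : EuclideanSpace ℝ (Fin N)} (hxy : ε < ‖x - y‖) {p q : Fin N → ℝ}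
    {T S : Finset (Fin N)} (hT : T.card = K) (hS : S.card = K)
    (hx : ∀ j, |x j - p j| ≤ if j ∈ T then τ else 0)
    (hy : ∀ j, |y j - q j| ≤ if j ∈ S then τ else 0) :
    ε ^ 2 / 4 ≤ ∑ j, (p j - q j) ^ 2 := by
  have h1 := norm_sub_le_of_abs_sub_le (p := WithLp.toLp 2 p) hx
  have h2 := norm_sub_le_of_abs_sub_le (p := WithLp.toLp 2 q) hy
  have h3 : ‖x - y‖ ≤ ‖x - WithLp.toLp 2 p‖ + ‖WithLp.toLp 2 p - WithLp.toLp 2 q‖ +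
      ‖y - WithLp.toLp 2 q‖ := by
    rw [norm_sub_rev y]
    calc ‖x - y‖ = ‖(x - WithLp.toLp 2 p) + (WithLp.toLp 2 p - WithLp.toLp 2 q) +
          (WithLp.toLp 2 q - y)‖ := by congr 1; abel
      _ ≤ _ := norm_add₃_le
  rw [hT] at h1
  rw [hS] at h2
  have h4 : ε / 2 ≤ ‖WithLp.toLp 2 p - WithLp.toLp 2 q‖ := by linarith
  have h5 : ‖WithLp.toLp 2 p - WithLp.toLp 2 q‖ ^ 2 = ∑ j, (p j - q j) ^ 2 := by
    rw [EuclideanSpace.real_norm_sq_eq]; simp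
  rw [← h5]
  nlinarith

/-! ### The union bound -/

lemma sensingLaw_real_few_separatingRows_le {M N K r : ℕ} {δ τ ε : ℝ} (hδ : 0 < δ) (hτ : 0 < τ)
    (hε : 0 < ε) (hτε : 64 * K * τ ≤ ε) {p q : Fin N → ℝ}
    (hpq : ε ^ 2 / 4 ≤ ∑ j, (p j - q j) ^ 2) {T S : Finset (Fin N)} (hT : T.card = K)
    (hS : S.card = K) :
    (sensingLaw M N δ).real
        {ω | {i | (ω.1 i, ω.2 i) ∈ separatingRows δ τ p q T S}.ncard ≤ r} ≤
      Real.exp (r - M * (1 / 4 * min 1 (ε / (8 * δ))) / 2) := by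
  have := isProbabilityMeasure_rowLaw (N := N) hδ
  have h := prob_card_le_le_exp (rowLaw N δ) M r (measurableSet_separatingRows δ τ p q T S)
    (le_rowLaw_separatingRows hδ hτ hε hτε hpq hT hS)
  rwa [← sensingLaw_real_rows hδ] at h

/-- The union bound over pairs of grid points at distance at least `ε / 2`: outside of an event of
probability at most `η`, more than `r` rows separate the cells of every such pair, and two vectors
at distance more than `ε` lie in the cells of such a pair. -/
lemma holdsWithProb_worstCaseError_le {M N K r n : ℕ} (hK : 1 ≤ K) (hKN : K ≤ N) {δ ε η : ℝ}
    (hδ : 0 < δ) (hε : 0 < ε) (hn : 64 * K / ε ≤ n)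
    (hη : ((sparseGrid N K n).card : ℝ) ^ 2 *
      Real.exp (r - M * (1 / 4 * min 1 (ε / (8 * δ))) / 2) ≤ η) :
    HoldsWithProb (sensingLaw M N δ) (1 - η)
      {ω | worstCaseError r δ ω.1 ω.2 (sparseVectors N K ∩ unitBall N) ≤ (ε : EReal)} := by
  classical
  have := isProbabilityMeasure_sensingLaw (M := M) (N := N) hδ
  have hK0 : (0 : ℝ) < K := by exact_mod_cast hK
  set τ : ℝ := ε / (64 * K) with hτdef
  have hτ : 0 < τ := by positivity
  have hτε : 64 * K * τ ≤ ε := by rw [hτdef, mul_div_cancel₀ _ (by positivity)]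
  have hnτ : 1 / τ ≤ n := by rwa [hτdef, one_div_div]
  set few : (Σ _ : Finset (Fin N), Fin N → ℤ) × (Σ _ : Finset (Fin N), Fin N → ℤ) →
      Set ((Fin M → Fin N → ℝ) × (Fin M → ℝ)) := fun z =>
    {ω | {i | (ω.1 i, ω.2 i) ∈ separatingRows δ τ (fun j => τ * z.1.2 j) (fun j => τ * z.2.2 j)
      z.1.1 z.2.1}.ncard ≤ r}
  set pairs := (sparseGrid N K n ×ˢ sparseGrid N K n).filter fun z =>
    ε ^ 2 / 4 ≤ ∑ j, (τ * z.1.2 j - τ * z.2.2 j) ^ 2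
  have hcard : ∀ g ∈ sparseGrid N K n, g.1.card = K := fun g hg =>
    (Finset.mem_powersetCard.1 (Finset.mem_sigma.1 hg).1).2
  set bad := ⋃ z ∈ pairs, few z
  have hbadle : (sensingLaw M N δ).real bad ≤ η := by
    refine (measureReal_biUnion_finset_le pairs few).trans (le_trans ?_ hη)
    refine (Finset.sum_le_card_nsmul pairs _ (Real.exp (r - M * (1 / 4 * min 1 (ε / (8 * δ))) / 2))
      fun z hz => ?_).trans ?_
    · obtain ⟨hz1, hz2⟩ := Finset.mem_filter.1 hz
      obtain ⟨hz3, hz4⟩ := Finset.mem_product.1 hz1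
      exact sensingLaw_real_few_separatingRows_le hδ hτ hε hτε hz2 (hcard _ hz3) (hcard _ hz4)
    · rw [nsmul_eq_mul]
      refine mul_le_mul_of_nonneg_right ?_ (Real.exp_nonneg _)
      have h := Finset.card_filter_le (sparseGrid N K n ×ˢ sparseGrid N K n) fun z =>
        ε ^ 2 / 4 ≤ ∑ j, (τ * z.1.2 j - τ * z.2.2 j) ^ 2
      rw [Finset.card_product, ← sq] at h
      exact_mod_cast h
  -- Passing to a measurable superset of `bad` of equal measure spares the measurability of `bad`.
  refine ⟨(toMeasurable (sensingLaw M N δ) bad)ᶜ, (measurableSet_toMeasurable _ _).compl, ?_, ?_⟩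
  · intro ω hω
    have hω' : ω ∉ bad := fun h => hω (subset_toMeasurable _ _ h)
    suffices h : ∀ x ∈ sparseVectors N K ∩ unitBall N,
        ∀ y ∈ relaxedCell r δ ω.1 ω.2 (sparseVectors N K ∩ unitBall N) x, ‖x - y‖ ≤ ε from
      (iSup₂_le fun x hx => iSup₂_le fun y hy => EReal.coe_le_coe_iff.2 (h x hx y hy) :
        worstCaseError r δ ω.1 ω.2 (sparseVectors N K ∩ unitBall N) ≤ (ε : EReal))
    intro x hx y hy
    by_contra! hlt
    obtain ⟨g, hg, hgx⟩ := exists_mem_sparseGrid hKN hτ hnτ hx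
    obtain ⟨g', hg', hgy⟩ := exists_mem_sparseGrid hKN hτ hnτ hy.1
    refine hω' (Set.mem_biUnion (x := (g, g')) ?_ (ncard_separatingRows_le hδ hgx hgy hy))
    exact Finset.mem_coe.2 (Finset.mem_filter.2 ⟨Finset.mem_product.2 ⟨hg, hg'⟩,
      sq_div_four_le_sum_sq_sub hε hτε hlt (hcard g hg) (hcard g' hg') hgx hgy⟩)
  · rw [prob_compl_eq_one_sub (measurableSet_toMeasurable _ _), measure_toMeasurable,
      ← ofReal_measureReal (measure_ne_top _ bad), ← ENNReal.ofReal_one,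
      ← ENNReal.ofReal_sub _ measureReal_nonneg]
    exact ENNReal.ofReal_le_ofReal (by linarith)

/-! ### Counting and choice of constants -/

lemma choose_le_exp_mul_div_pow (N : ℕ) {K : ℕ} (hK : 1 ≤ K) :
    (N.choose K : ℝ) ≤ (Real.exp 1 * N / K) ^ K := by
  have hK0 : (0 : ℝ) < K := by exact_mod_cast hK
  have h1 := Real.pow_div_factorial_le_exp (K : ℝ) hK0.le K
  have hf : (0 : ℝ) < (K.factorial : ℝ) := by exact_mod_cast K.factorial_pos
  have he : Real.exp (K : ℝ) = Real.exp 1 ^ K := by rw [← Real.exp_nat_mul, mul_one]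
  refine (Nat.choose_le_pow_div K N).trans ?_
  rw [div_pow, mul_pow, ← he, div_le_div_iff₀ hf (by positivity)]
  rw [div_le_iff₀ hf] at h1
  nlinarith [pow_nonneg (Nat.cast_nonneg N : (0 : ℝ) ≤ N) K]

lemma card_sparseGrid_le {M N K n : ℕ} (hM : 3 ≤ M) (hK : 1 ≤ K) (hKN : K ≤ N)
    (hn : (2 * n + 1 : ℝ) ≤ 134 * M) :
    ((sparseGrid N K n).card : ℝ) ≤ ((M : ℝ) * max (N : ℝ) (M : ℝ) / K) ^ (7 * K) := by
  have hK0 : (0 : ℝ) < K := by exact_mod_cast hK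
  have hKN' : (K : ℝ) ≤ N := by exact_mod_cast hKN
  have hM' : (3 : ℝ) ≤ M := by exact_mod_cast hM
  set L := (M : ℝ) * max (N : ℝ) (M : ℝ) / K with hL
  have hL1 : (M : ℝ) * N / K ≤ L := by
    rw [hL]; gcongr; exact le_max_left _ _
  have hL3 : 3 ≤ L := by
    refine le_trans ?_ hL1
    rw [le_div_iff₀ hK0]; nlinarith
  rw [card_sparseGrid]
  push_cast
  rw [pow_mul]
  have he : Real.exp 1 ≤ 3 := by have := Real.exp_one_lt_d9; linarith
  have h6 : (402 : ℝ) ≤ L ^ 6 := by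
    have := pow_le_pow_left₀ (by norm_num) hL3 6
    norm_num at this; linarith
  calc (N.choose K : ℝ) * (2 * n + 1) ^ K
      ≤ (Real.exp 1 * N / K) ^ K * (134 * M) ^ K := by
        gcongr; exact choose_le_exp_mul_div_pow N hK
    _ = (Real.exp 1 * 134 * (M * N / K)) ^ K := by rw [← mul_pow]; congr 1; ring
    _ ≤ (L ^ 7) ^ K := by
        gcongr
        calc Real.exp 1 * 134 * (M * N / K) ≤ 3 * 134 * L := by gcongr
          _ ≤ L ^ 6 * L := by nlinarith
          _ = L ^ 7 := by ring

/-- The logarithmic factor of the error bound, although `log (1 / (2 η))` can be negative, is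
comparable with `log L + log (1 / η)`; this uses `2 ^ 3 ≤ 3 ^ 2 ≤ L ^ 2`. -/
lemma log_add_log_le {L η : ℝ} (hL : 3 ≤ L) (hη : 0 < η) (hη1 : η < 1) :
    Real.log L - Real.log η ≤ 3 * (Real.log L + Real.log (1 / (2 * η))) := by
  rw [one_div, Real.log_inv, Real.log_mul (by norm_num) hη.ne']
  have h1 : Real.log η ≤ 0 := Real.log_nonpos hη.le hη1.le
  have h2 : Real.log 3 ≤ Real.log L := Real.log_le_log (by norm_num) hL
  have h3 : 3 * Real.log 2 ≤ 2 * Real.log 3 := by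
    have h := Real.log_le_log (by norm_num) (show (2 : ℝ) ^ 3 ≤ 3 ^ 2 by norm_num)
    rw [Real.log_pow, Real.log_pow] at h
    exact_mod_cast h
  linarith

/-- The error bound for sparse vectors, with constant `84 / κ`, where `κ ε` is the lower bound for
the probability that a row separates two cells at distance of order `ε ≤ 2`. -/
lemma holdsWithProb_sparse {Δ : ℝ} (hΔ : 0 < Δ) {κ : ℝ}
    (hκ : κ = 1 / 4 * min (1 / 2) (1 / (8 * Δ))) {M N K r : ℕ} {δ η : ℝ} (hM : 3 ≤ M)
    (hK : 1 ≤ K) (hKN : K ≤ N) (hδ : 0 < δ) (hδΔ : δ ≤ Δ) (hη : 0 < η) (hη1 : η < 1) :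
    HoldsWithProb (sensingLaw M N δ) (1 - η)
      {ω | worstCaseError r δ ω.1 ω.2 (sparseVectors N K ∩ unitBall N) ≤
        ((84 / κ * (((K : ℝ) + r) / M) *
          (Real.log ((M : ℝ) * max (N : ℝ) (M : ℝ) / K) + Real.log (1 / (2 * η))) : ℝ) :
            EReal)} := by
  have hκ0 : 0 < κ := by rw [hκ]; positivity
  have hκ8 : κ ≤ 1 / 8 := by
    rw [hκ]; have := min_le_left (1 / 2 : ℝ) (1 / (8 * Δ)); linarith
  have hK0 : (1 : ℝ) ≤ K := by exact_mod_cast hK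
  have hKN' : (K : ℝ) ≤ N := by exact_mod_cast hKN
  have hM' : (3 : ℝ) ≤ M := by exact_mod_cast hM
  have hr : (0 : ℝ) ≤ r := Nat.cast_nonneg r
  set L := (M : ℝ) * max (N : ℝ) (M : ℝ) / K with hL
  have hL3 : 3 ≤ L := by
    rw [hL, le_div_iff₀ (by linarith)]
    have := le_max_left (N : ℝ) M
    nlinarith
  have hlog := log_add_log_le hL3 hη hη1
  set l := Real.log L + Real.log (1 / (2 * η))
  have ha : 1 ≤ Real.log L := by
    rw [Real.le_log_iff_exp_le (by linarith)]
    have := Real.exp_one_lt_d9; linarith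
  have hb : Real.log η ≤ 0 := Real.log_nonpos hη.le hη1.le
  have hl : 1 / 3 ≤ l := by linarith
  set ε := 84 / κ * (((K : ℝ) + r) / M) * l with hεdef
  have hκε : κ * ε * M = 84 * (K + r) * l := by
    rw [hεdef]; field_simp
  have hε : 0 < ε := by positivity
  -- If `2 ≤ ε`, the bound holds surely, since two points of the unit ball are at most `2` apart.
  rcases le_or_gt 2 ε with h2 | h2
  · have := isProbabilityMeasure_sensingLaw (M := M) (N := N) hδ
    refine ⟨Set.univ, MeasurableSet.univ, fun ω _ => ?_, ?_⟩
    · refine iSup₂_le fun x hx => iSup₂_le fun y hy => EReal.coe_le_coe_iff.2 ?_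
      have hx1 : ‖x‖ ≤ 1 := hx.2
      have hy1 : ‖y‖ ≤ 1 := hy.1.2
      have := norm_sub_le x y
      linarith
    · rw [measure_univ, ← ENNReal.ofReal_one]
      exact ENNReal.ofReal_le_ofReal (by linarith)
  have hKε : K / ε ≤ M := by
    rw [div_le_iff₀ hε]
    nlinarith [mul_nonneg hε.le (by linarith : (0:ℝ) ≤ M), mul_nonneg hr (by linarith : 0 ≤ l),
      mul_le_mul_of_nonneg_left hl (by linarith : (0:ℝ) ≤ K)]
  refine holdsWithProb_worstCaseError_le (n := ⌈64 * K / ε⌉₊) hK hKN hδ hε (Nat.le_ceil _) ?_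
  have hn : (2 * (⌈64 * K / ε⌉₊ : ℝ) + 1) ≤ 134 * M := by
    have h1 := (Nat.ceil_lt_add_one (show 0 ≤ 64 * K / ε by positivity)).le
    have h3 : 1 / 2 ≤ K / ε := by
      rw [div_le_div_iff₀ (by norm_num) hε]; linarith
    rw [mul_div_assoc] at h1 ⊢
    linarith
  have hcard := card_sparseGrid_le hM hK hKN hn
  rw [← hL] at hcard
  have hp : κ * ε ≤ 1 / 4 * min 1 (ε / (8 * δ)) := by
    rw [hκ, mul_assoc]
    gcongr
    refine le_min ?_ ?_
    · have := mul_le_mul_of_nonneg_right (min_le_left (1 / 2 : ℝ) (1 / (8 * Δ))) hε.le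
      linarith
    · calc min (1 / 2) (1 / (8 * Δ)) * ε ≤ 1 / (8 * Δ) * ε := by gcongr; exact min_le_right _ _
        _ = ε / (8 * Δ) := by ring
        _ ≤ ε / (8 * δ) := by gcongr
  calc ((sparseGrid N K ⌈64 * K / ε⌉₊).card : ℝ) ^ 2 *
        Real.exp (r - M * (1 / 4 * min 1 (ε / (8 * δ))) / 2)
      ≤ (L ^ (7 * K)) ^ 2 * Real.exp (r - M * (κ * ε) / 2) := by gcongr
    _ = Real.exp (14 * K * Real.log L + (r - M * (κ * ε) / 2)) := by
        rw [Real.exp_add, ← pow_mul]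
        congr 1
        rw [← Real.exp_log (pow_pos (by linarith : 0 < L) _), Real.log_pow]
        congr 1; push_cast; ring
    _ ≤ Real.exp (Real.log η) := by
        -- `M κ ε / 2 = 42 (K + r) l ≥ 14 (K + r) (log L - log η) ≥ 14 K log L + r - log η`
        refine Real.exp_le_exp.2 ?_
        nlinarith [mul_le_mul_of_nonneg_left hlog (by linarith : 0 ≤ (K : ℝ) + r),
          mul_nonneg hr (by linarith : 0 ≤ Real.log L - 1),
          mul_nonneg hr (by linarith : 0 ≤ - Real.log η),
          mul_nonneg (by linarith : 0 ≤ (K : ℝ) - 1) (by linarith : 0 ≤ - Real.log η)]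
    _ = η := Real.exp_log hη

end QuantizedSensing

end

open QuantizedSensing in
theorem theorem3 (Δ : ℝ) (hΔ : 0 < Δ) :
    ∃ C C' : ℝ, 0 < C ∧ 0 < C' ∧
      (∀ (M N r : ℕ) (δ η : ℝ), 3 ≤ M → 1 ≤ N → 0 < δ → δ ≤ Δ → 0 < η → η < 1 →
        HoldsWithProb (sensingLaw M N δ) (1 - η)
          {ω | worstCaseError r δ ω.1 ω.2 (unitBall N) ≤
            ((C * (((N : ℝ) + r) / M) *
              (Real.log ((M : ℝ) * max (N : ℝ) (M : ℝ) / N) + Real.log (1 / (2 * η))) : ℝ) :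
                EReal)}) ∧
      (∀ (M N K r : ℕ) (δ η : ℝ), 3 ≤ M → 1 ≤ K → K ≤ N → 0 < δ → δ ≤ Δ → 0 < η → η < 1 →
        HoldsWithProb (sensingLaw M N δ) (1 - η)
          {ω | worstCaseError r δ ω.1 ω.2 (sparseVectors N K ∩ unitBall N) ≤
            ((C' * (((K : ℝ) + r) / M) *
              (Real.log ((M : ℝ) * max (N : ℝ) (M : ℝ) / K) + Real.log (1 / (2 * η))) : ℝ) :
                EReal)}) := by
  have hC : 0 < 84 / (1 / 4 * min (1 / 2) (1 / (8 * Δ))) := by positivity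
  refine ⟨_, _, hC, hC, fun M N r δ η hM hN hδ hδΔ hη hη1 => ?_,
    fun M N K r δ η hM hK hKN hδ hδΔ hη hη1 =>
      holdsWithProb_sparse hΔ rfl hM hK hKN hδ hδΔ hη hη1⟩
  have h := holdsWithProb_sparse hΔ rfl (r := r) hM hN le_rfl hδ hδΔ hη hη1
  have hball : sparseVectors N N ∩ unitBall N = unitBall N :=
    Set.inter_eq_right.2 fun x _ => (Set.ncard_le_card _).trans (by simp)
  rwa [hball] at h
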